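/- Let $n\ge 0$, let $X$ be uniformly distributed on $\{0,1\}^n$, and let $g:\{0,1\}^n\to\mathbb R$ satisfy $|g(x\oplus e_i)-g(x)|\le 1$ for all $x\in\{0,1\}^n$ and $i\in\{1,\dots,n\}$, where $x\oplus e_i$ is $x$ with its $i$-th coordinate flipped. Let $p\in[0,2]$, and write $\|f\|_p=(\mathbb E[f(X)^p])^{1/p}$ for $p>0$ and $\|f\|_0=\exp(\mathbb E[\ln f(X)])$ for positive $f$ on $\{0,1\}^n$. Let $h(y)=-y\ln y-(1-y)\ln(1-y)$ be the binary entropy function, let $h^{-1}:[0,\ln 2]\to[0,1/2]$ be the inverse of its restriction to $[0,1/2]$, and put $y(\alpha)=h^{-1}(\ln 2-\alpha)$. For $s\ge 0$ let $$\Xi_s(\alpha)=\begin{cases}\dfrac{1}{2(s-1)}\Bigl(1-y^{\frac1s}(1-y)^{\frac{s-1}{s}}-y^{\frac{s-1}{s}}(1-y)^{\frac1s}\Bigr), & s\ne 0,1,\\[2mm] \bigl(\tfrac12-y\bigr)\ln\dfrac{1-y}{y}, & s=1,\\[2mm] \tfrac14\bigl(e^{2\sqrt{2\alpha}}+e^{-2\sqrt{2\alpha}}\bigr)-\tfrac12,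 & s=0,\end{cases}\qquad y=y(\alpha),$$ for $\alpha\in[0,\ln 2]$ if $s>1$, for $\alpha\in[0,\ln 2)$ if $0<s\le 1$, and for $\alpha\in[0,\infty)$ if $s=0$. Let $\Xi_s^{-1}(t)=\sup\{\alpha:\Xi_s(\alpha)\le t\}$ for $t\ge 0$ (the inverse of $\Xi_s$, equal to $\ln 2$ when $s>1$ and $t$ exceeds the maximum of $\Xi_s$). Let $$\beta(s)=\frac{(e-1)(e^{s-1}-1)}{2(s-1)}\quad(s\ne 1),\qquad \beta(1)=\frac{e-1}{2}.$$ Then $s\mapsto \Xi_s^{-1}(\beta(s))\,s^{-2}$ is integrable on $[p,2]$, and for every $r\in\mathbb R$, $$\mathbb P\bigl\{g(X)-\ln\|e^g\|_p\ge r\bigr\}\le\exp\Bigl\{\inf_{q\in[p,2]}\Bigl(nq\int_p^q\Xi_s^{-1}(\beta(s))\,s^{-2}\,ds-rq\Bigr)\Bigr\}.$$ -/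

import Mathlib

open MeasureTheory ProbabilityTheory

noncomputable section

namespace Hypercube

/-- The uniform probability measure on the discrete hypercube `{0,1}ⁿ`. -/
def unif (n : ℕ) : Measure (Fin n → Bool) := uniformOn Set.univ

/-- The point `x ⊕ eᵢ`, i.e. `x` with its `i`-th bit flipped. -/
def flip {n : ℕ} (x : Fin n → Bool) (i : Fin n) : Fin n → Bool :=
  Function.update x i (!(x i))

/-- The discrete derivative `∇ᵢ g (x) = g (x ⊕ eᵢ) - g x`. -/
def grad {n : ℕ} (g : (Fin n → Bool) → ℝ) (i : Fin n) (x : Fin n → Bool) : ℝ :=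
  g (flip x i) - g x

/-- The `p`-norm `‖f‖_p = (E[f^p])^(1/p)` of a positive function on the hypercube, under the
uniform measure, with the usual convention `‖f‖_0 = exp (E[ln f])`. -/
def pNorm {n : ℕ} (p : ℝ) (f : (Fin n → Bool) → ℝ) : ℝ :=
  if p = 0 then Real.exp (∫ x, Real.log (f x) ∂(unif n))
  else (∫ x, f x ^ p ∂(unif n)) ^ (1 / p)

/-- The inverse `h⁻¹ : [0, ln 2] → [0, 1/2]` of the binary entropy function (base `e`)
restricted to `[0, 1/2]`. -/
def hInv : ℝ → ℝ := Function.invFunOn Real.binEntropy (Set.Icc 0 2⁻¹)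

theorem hInv_spec {t : ℝ} (h0 : 0 ≤ t) (h1 : t ≤ Real.log 2) :
    hInv t ∈ Set.Icc (0 : ℝ) 2⁻¹ ∧ Real.binEntropy (hInv t) = t := by
  have hsurj : ∃ a ∈ Set.Icc (0 : ℝ) 2⁻¹, Real.binEntropy a = t := by
    have := intermediate_value_Icc (a := (0 : ℝ)) (b := 2⁻¹) (by norm_num)
      Real.binEntropy_continuous.continuousOn
    rw [Real.binEntropy_zero, Real.binEntropy_two_inv] at this
    obtain ⟨a, ha, hat⟩ := this ⟨h0, h1⟩
    exact ⟨a, ha, hat⟩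
  exact ⟨Function.invFunOn_mem hsurj, Function.invFunOn_eq hsurj⟩

/-- `y(α) = h⁻¹ (ln 2 - α)`. -/
def yOf (α : ℝ) : ℝ := hInv (Real.log 2 - α)

/-- The explicit log-Sobolev function `Ξ_q(α)` of the uniform measure on `{0,1}`.
Note that `1 / q' = (q - 1) / q` for the Hölder conjugate `q' = q / (q - 1)`. -/
def Xi (q α : ℝ) : ℝ :=
  if q = 0 then
    1 / 4 * (Real.exp (2 * √(2 * α)) + Real.exp (-(2 * √(2 * α)))) - 1 / 2
  else if q = 1 then
    (1 / 2 - yOf α) * Real.log ((1 - yOf α) / yOf α)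
  else
    1 / (2 * (q - 1)) *
      (1 - yOf α ^ (1 / q) * (1 - yOf α) ^ ((q - 1) / q)
        - yOf α ^ ((q - 1) / q) * (1 - yOf α) ^ (1 / q))

/-- The set of `α` at which `Ξ_q` is defined and finite: `[0, ∞)` for `q = 0`, `[0, ln 2]` for
`q > 1`, and `[0, ln 2)` for the other `q`, for which `Ξ_q(α) → ∞` as `α → ln 2`. -/
def XiDom (q : ℝ) : Set ℝ :=
  if q = 0 then Set.Ici 0
  else if 1 < q then Set.Icc 0 (Real.log 2)
  else Set.Ico 0 (Real.log 2)

/-- The inverse `Ξ_q⁻¹(t)` of the increasing function `Ξ_q`, for `t ≥ 0`: the largest `α` with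
`Ξ_q(α) ≤ t`. It is the ordinary inverse on the range of `Ξ_q`; when `q > 1` and `t` exceeds the
maximum `1 / (2 (q - 1))` of `Ξ_q`, it is `ln 2`. -/
def XiInv (q t : ℝ) : ℝ := sSup {α | α ∈ XiDom q ∧ Xi q α ≤ t}

/-- `β(s) = (e - 1) (e^(s-1) - 1) / (2 (s - 1))`, extended by continuity to `s = 1`. -/
def beta (s : ℝ) : ℝ :=
  if s = 1 then (Real.exp 1 - 1) / 2
  else (Real.exp 1 - 1) * (Real.exp (s - 1) - 1) / (2 * (s - 1))

end Hypercube

end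

/-! Herbst's argument. The derivative of `s ↦ ln ‖e^g‖_s` is `s⁻²` times the relative entropy,
against the uniform law, of the law tilted by `e^{sg}`. Bounding that entropy by `n Ξ_s⁻¹(β(s))`
(`tilted_entropy_le`), integrating over `[p,q]` and applying Chernoff at exponent `q` gives the
tail.

The entropy bound needs no log-Sobolev inequality on the cube. A flip changes `e^{sg}` by a factor
at most `e^s`, and this survives summing out coordinates, so the chain rule
(`entropy_le_of_flip_le`) reduces to two-point laws with log-odds `τ ≤ s`. For those `Ξ_s ≤ β(s)` is
explicit (`Xi_relEntropy_le_beta`).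

Integrability needs measurability in `s`, from monotonicity of `Ξ_s`, and a bound `O(s²)` on the
inverse near `0`. -/

namespace Hypercube

/-! ### Two-point laws parametrised by log-odds. -/

/-- The smaller weight of the law on `{0,1}` whose log-odds are `τ ≥ 0`. -/
noncomputable def minorWeight (τ : ℝ) : ℝ := (1 + Real.exp τ)⁻¹

/-- The relative entropy, with respect to the uniform law on `{0,1}`, of the law with log-odds
`τ`. -/
noncomputable def relEntropy (τ : ℝ) : ℝ := Real.log 2 - Real.binEntropy (minorWeight τ)

theorem minorWeight_pos (τ : ℝ) : 0 < minorWeight τ := by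
  unfold minorWeight; positivity

theorem minorWeight_mem {τ : ℝ} (hτ : 0 ≤ τ) : minorWeight τ ∈ Set.Icc (0 : ℝ) 2⁻¹ := by
  refine ⟨(minorWeight_pos τ).le, ?_⟩
  unfold minorWeight
  gcongr
  linarith [Real.one_le_exp hτ]

theorem one_sub_minorWeight (τ : ℝ) : 1 - minorWeight τ = minorWeight τ * Real.exp τ := by
  unfold minorWeight
  have : 0 < 1 + Real.exp τ := by positivity
  field_simp
  ring

theorem minorWeight_strictAnti : StrictAnti minorWeight := by
  intro a b hab
  unfold minorWeight
  gcongr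

theorem relEntropy_strictMonoOn : StrictMonoOn relEntropy (Set.Ici 0) := by
  intro a ha b hb hab
  have := Real.binEntropy_strictMonoOn (minorWeight_mem hb) (minorWeight_mem ha)
    (minorWeight_strictAnti hab)
  unfold relEntropy
  linarith

theorem relEntropy_zero : relEntropy 0 = 0 := by
  have : minorWeight 0 = 2⁻¹ := by norm_num [minorWeight]
  rw [relEntropy, this, Real.binEntropy_two_inv, sub_self]

theorem relEntropy_nonneg (τ : ℝ) : 0 ≤ relEntropy τ :=
  sub_nonneg.2 Real.binEntropy_le_log_two

theorem minorWeight_lt_one (τ : ℝ) : minorWeight τ < 1 := by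
  have := one_sub_minorWeight τ
  have := mul_pos (minorWeight_pos τ) (Real.exp_pos τ)
  linarith

theorem relEntropy_lt_log_two (τ : ℝ) : relEntropy τ < Real.log 2 := by
  have := Real.binEntropy_pos (minorWeight_pos τ) (minorWeight_lt_one τ)
  unfold relEntropy
  linarith

theorem exists_relEntropy_eq {α : ℝ} (h0 : 0 ≤ α) (h1 : α < Real.log 2) :
    ∃ τ, 0 ≤ τ ∧ relEntropy τ = α := by
  obtain ⟨⟨hy0, hy1⟩, hy⟩ := hInv_spec (t := Real.log 2 - α) (by linarith) (by linarith)
  set y := hInv (Real.log 2 - α)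
  have hypos : 0 < y := by
    refine lt_of_le_of_ne hy0 fun h => ?_
    rw [← h, Real.binEntropy_zero] at hy
    linarith
  have hodds : 1 ≤ (1 - y) / y := by
    rw [le_div_iff₀ hypos]; norm_num at hy1; linarith
  refine ⟨Real.log ((1 - y) / y), Real.log_nonneg hodds, ?_⟩
  have : minorWeight (Real.log ((1 - y) / y)) = y := by
    rw [minorWeight, Real.exp_log (by linarith)]
    field_simp
    ring
  rw [relEntropy, this, hy]
  ring

theorem yOf_relEntropy {τ : ℝ} (hτ : 0 ≤ τ) : yOf (relEntropy τ) = minorWeight τ := by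
  have h := hInv_spec (t := Real.log 2 - relEntropy τ)
    (by linarith [relEntropy_lt_log_two τ]) (by linarith [relEntropy_nonneg τ])
  refine Real.binEntropy_strictMonoOn.injOn h.1 (minorWeight_mem hτ) ?_
  rw [h.2, relEntropy]
  ring

/-- Relative entropy is at most the chi-square divergence `(1 - 2y)²`, and `1 - 2y = tanh (τ/2) ≤
τ`. -/
theorem relEntropy_le_sq {τ : ℝ} (hτ : 0 ≤ τ) : relEntropy τ ≤ τ ^ 2 := by
  have hy := minorWeight_pos τ
  have hy1 := minorWeight_lt_one τ
  have h1 := Real.log_le_sub_one_of_pos (x := 2 * minorWeight τ) (by positivity)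
  have h2 := Real.log_le_sub_one_of_pos (x := 2 * (1 - minorWeight τ)) (by linarith)
  rw [Real.log_mul (by norm_num) hy.ne'] at h1
  rw [Real.log_mul (by norm_num) (by linarith)] at h2
  have hchi : relEntropy τ ≤ (1 - 2 * minorWeight τ) ^ 2 := by
    rw [relEntropy, Real.binEntropy, Real.log_inv, Real.log_inv]
    have m1 := mul_le_mul_of_nonneg_left h1 hy.le
    have m2 := mul_le_mul_of_nonneg_left h2 (sub_nonneg.2 hy1.le)
    nlinarith
  have hlin : 1 - 2 * minorWeight τ ≤ τ := by
    have e := one_sub_minorWeight τ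
    have h3 := Real.add_one_le_exp (-τ)
    rw [Real.exp_neg] at h3
    have h4 : (1 - τ) * Real.exp τ ≤ 1 := by
      have := mul_le_mul_of_nonneg_right h3 (Real.exp_pos τ).le
      rw [inv_mul_cancel₀ (Real.exp_pos τ).ne'] at this
      linarith
    have h5 := mul_le_mul_of_nonneg_left h4 hy.le
    nlinarith
  have := (minorWeight_mem hτ).2
  norm_num at this
  exact hchi.trans (pow_le_pow_left₀ (by linarith) hlin 2)

/-! ### `Ξ_s` as a function of the log-odds. -/

theorem Xi_relEntropy {s τ : ℝ} (hs : 0 < s) (hs1 : s ≠ 1) (hτ : 0 ≤ τ) :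
    Xi s (relEntropy τ) = 1 / (2 * (s - 1)) *
      (1 - minorWeight τ * (Real.exp (τ / s) + Real.exp (τ * ((s - 1) / s)))) := by
  have hy := minorWeight_pos τ
  have key : ∀ a b : ℝ, a + b = 1 →
      minorWeight τ ^ a * (1 - minorWeight τ) ^ b = minorWeight τ * Real.exp (τ * b) := by
    intro a b hab
    rw [one_sub_minorWeight, Real.mul_rpow hy.le (Real.exp_pos τ).le, ← mul_assoc,
      ← Real.rpow_add hy, hab, Real.rpow_one, ← Real.exp_mul]
  rw [Xi, if_neg hs.ne', if_neg hs1, yOf_relEntropy hτ, key _ _ (by field_simp; ring),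
    key _ _ (by field_simp; ring), mul_one_div]
  ring

/-- The two exponents sum to `τ`, so `1 + e^τ` minus the two exponentials factors. At `τ = s` the
factor beside `minorWeight τ` is exactly `β(s)`. -/
theorem Xi_relEntropy_eq_mul {s τ : ℝ} (hs : 0 < s) (hs1 : s ≠ 1) (hτ : 0 ≤ τ) :
    Xi s (relEntropy τ) = minorWeight τ * ((Real.exp (τ / s) - 1) *
      (Real.exp (τ / s * (s - 1)) - 1) / (2 * (s - 1))) := by
  rw [Xi_relEntropy hs hs1 hτ]
  have h1 : (1 : ℝ) = minorWeight τ * (1 + Real.exp τ) := by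
    have := one_sub_minorWeight τ; linarith
  have h2 : Real.exp τ = Real.exp (τ / s) * Real.exp (τ / s * (s - 1)) := by
    rw [← Real.exp_add]; congr 1; field_simp; ring
  have h3 : τ * ((s - 1) / s) = τ / s * (s - 1) := by ring
  have h4 : s - 1 ≠ 0 := sub_ne_zero.2 hs1
  rw [h3]
  have h5 : 1 - minorWeight τ * (Real.exp (τ / s) + Real.exp (τ / s * (s - 1))) =
      minorWeight τ * ((Real.exp (τ / s) - 1) * (Real.exp (τ / s * (s - 1)) - 1)) := by
    nth_rw 1 [h1]
    rw [h2]
    ring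
  rw [h5]
  field_simp

theorem Xi_relEntropy_eq_cosh {s τ : ℝ} (hs : 0 < s) (hs1 : s ≠ 1) (hτ : 0 ≤ τ) :
    Xi s (relEntropy τ) = 1 / (2 * (s - 1)) *
      (1 - Real.cosh ((1 - 2 / s) * (τ / 2)) / Real.cosh (τ / 2)) := by
  rw [Xi_relEntropy hs hs1 hτ]
  congr 2
  have h1 : minorWeight τ = Real.exp (-(τ / 2)) / (2 * Real.cosh (τ / 2)) := by
    rw [minorWeight, eq_div_iff (by positivity), inv_mul_eq_iff_eq_mul₀ (by positivity),
      Real.cosh_eq, add_mul, ← Real.exp_add]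
    ring_nf
  have h2 : Real.exp (-(τ / 2)) * (Real.exp (τ / s) + Real.exp (τ * ((s - 1) / s))) =
      2 * Real.cosh ((1 - 2 / s) * (τ / 2)) := by
    rw [Real.cosh_eq, mul_add, ← Real.exp_add, ← Real.exp_add]
    have e1 : -(τ / 2) + τ / s = -((1 - 2 / s) * (τ / 2)) := by ring
    have e2 : -(τ / 2) + τ * ((s - 1) / s) = (1 - 2 / s) * (τ / 2) := by field_simp; ring
    rw [e1, e2]
    ring
  rw [h1, div_mul_eq_mul_div, h2, mul_div_mul_left _ _ two_ne_zero]

/-- Product-to-sum formulas reduce this to `|au ± t| ≤ |at ± u|`. It says that `cosh (at) / cosh t`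
decreases in `t ≥ 0`. -/
theorem cosh_mul_cosh_le {a t u : ℝ} (ha : |a| ≤ 1) (ht : 0 ≤ t) (htu : t ≤ u) :
    Real.cosh (a * u) * Real.cosh t ≤ Real.cosh (a * t) * Real.cosh u := by
  obtain ⟨ha1, ha2⟩ := abs_le.1 ha
  have p1 : ∀ x y : ℝ, Real.cosh x * Real.cosh y =
      (Real.cosh (x + y) + Real.cosh (x - y)) / 2 := by
    intro x y; rw [Real.cosh_add, Real.cosh_sub]; ring
  have hle : ∀ b : ℝ, -1 ≤ b → b ≤ 1 → |b * u + t| ≤ |b * t + u| := by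
    intro b hb1 hb2
    have : 0 ≤ b * t + u := by nlinarith
    rw [abs_of_nonneg this, abs_le]
    constructor <;> nlinarith
  have q1 := Real.cosh_le_cosh.2 (hle a ha1 ha2)
  have q2 : Real.cosh (a * u - t) ≤ Real.cosh (a * t - u) := by
    rw [Real.cosh_le_cosh, ← abs_neg (a * u - t), ← abs_neg (a * t - u)]
    have := hle (-a) (by linarith) (by linarith)
    convert this using 2 <;> ring
  rw [p1, p1]
  linarith

theorem cosh_le_mul_cosh {a t u : ℝ} (ha : 1 ≤ |a|) (ht : 0 ≤ t) (htu : t ≤ u) :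
    Real.cosh (a * t) * Real.cosh u ≤ Real.cosh (a * u) * Real.cosh t := by
  have ha0 : 0 < |a| := by linarith
  have h := cosh_mul_cosh_le (a := |a|⁻¹) (t := |a| * t) (u := |a| * u)
    (by rw [abs_inv, abs_abs]; exact inv_le_one_of_one_le₀ ha) (by positivity) (by gcongr)
  have e : ∀ x : ℝ, 0 ≤ x → Real.cosh (|a| * x) = Real.cosh (a * x) := by
    intro x hx
    rw [← Real.cosh_abs (a * x), abs_mul, abs_of_nonneg hx]
  rw [inv_mul_cancel_left₀ ha0.ne', inv_mul_cancel_left₀ ha0.ne', e _ ht,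
    e _ (ht.trans htu)] at h
  linarith

/-- With `a = 1 - 2/s`, the condition `|a| ≤ 1` switches at `s = 1`, exactly where the prefactor `1
/ (2(s-1))` changes sign. -/
theorem Xi_relEntropy_mono {s t u : ℝ} (hs : 0 < s) (hs1 : s ≠ 1) (ht : 0 ≤ t) (htu : t ≤ u) :
    Xi s (relEntropy t) ≤ Xi s (relEntropy u) := by
  rw [Xi_relEntropy_eq_cosh hs hs1 ht, Xi_relEntropy_eq_cosh hs hs1 (ht.trans htu)]
  have hc := Real.cosh_pos (t / 2)
  have hc' := Real.cosh_pos (u / 2)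
  have h2s : 0 < 2 / s := by positivity
  rcases lt_or_gt_of_ne hs1 with h | h
  · have ha : 1 ≤ |1 - 2 / s| := by
      have : 2 ≤ 2 / s := by rw [le_div_iff₀ hs]; linarith
      rw [abs_of_nonpos (by linarith)]; linarith
    refine mul_le_mul_of_nonpos_left ?_ (one_div_nonpos.2 (by linarith))
    gcongr 1 - ?_
    rw [div_le_div_iff₀ hc hc']
    exact cosh_le_mul_cosh ha (by linarith) (by linarith)
  · have ha : |1 - 2 / s| ≤ 1 := by
      have : 2 / s ≤ 2 := by rw [div_le_iff₀ hs]; linarith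
      rw [abs_le]; constructor <;> linarith
    refine mul_le_mul_of_nonneg_left ?_ (one_div_nonneg.2 (by linarith))
    gcongr 1 - ?_
    rw [div_le_div_iff₀ hc' hc]
    exact cosh_mul_cosh_le ha (by linarith) (by linarith)

theorem exp_mul_sub_one_div_nonneg {c d : ℝ} (hc : c ≠ 0) (hd : 0 ≤ d) :
    0 ≤ (Real.exp (d * c) - 1) / (2 * c) := by
  rcases lt_or_gt_of_ne hc with h | h
  · refine div_nonneg_of_nonpos ?_ (by linarith)
    rw [sub_nonpos, Real.exp_le_one_iff]
    exact mul_nonpos_of_nonneg_of_nonpos hd h.le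
  · refine div_nonneg ?_ (by linarith)
    rw [sub_nonneg, Real.one_le_exp_iff]
    positivity

theorem exp_mul_sub_one_div_le {c d : ℝ} (hc : c ≠ 0) (hd : d ≤ 1) :
    (Real.exp (d * c) - 1) / (2 * c) ≤ (Real.exp c - 1) / (2 * c) := by
  rcases lt_or_gt_of_ne hc with h | h
  · refine div_le_div_of_nonpos_of_le (by linarith) ?_
    gcongr
    nlinarith
  · gcongr
    nlinarith

theorem Xi_relEntropy_le_beta {s τ : ℝ} (hs : 0 < s) (hτ : 0 ≤ τ) (hτs : τ ≤ s) :
    Xi s (relEntropy τ) ≤ beta s := by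
  have hy := minorWeight_pos τ
  by_cases h1 : s = 1
  · subst h1
    rw [Xi, if_neg one_ne_zero, if_pos rfl, beta, if_pos rfl, yOf_relEntropy hτ,
      one_sub_minorWeight, mul_div_cancel_left₀ _ hy.ne', Real.log_exp]
    have := Real.add_one_le_exp 1
    nlinarith
  · rw [Xi_relEntropy_eq_mul hs h1 hτ, beta, if_neg h1, mul_div_assoc, mul_div_assoc]
    have hs1 : s - 1 ≠ 0 := sub_ne_zero.2 h1
    have hd0 : 0 ≤ τ / s := by positivity
    have hd1 : τ / s ≤ 1 := div_le_one_of_le₀ hτs hs.le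
    have n1 : 0 ≤ Real.exp (τ / s) - 1 := by linarith [Real.one_le_exp hd0]
    have n2 := exp_mul_sub_one_div_nonneg hs1 hd0
    refine (mul_le_of_le_one_left (by positivity) (minorWeight_lt_one τ).le).trans ?_
    have n3 : Real.exp (τ / s) - 1 ≤ Real.exp 1 - 1 := by gcongr
    exact mul_le_mul n3 (exp_mul_sub_one_div_le hs1 hd1) n2 (n1.trans n3)

/-! ### Bounds on the inverse of `Ξ_s` at `β(s)`. -/

theorem Ico_subset_XiDom {s : ℝ} (hs : 0 < s) : Set.Ico 0 (Real.log 2) ⊆ XiDom s := by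
  unfold XiDom
  rw [if_neg hs.ne']
  split_ifs
  · exact Set.Ico_subset_Icc_self
  · exact subset_rfl

theorem XiDom_subset_Icc {s : ℝ} (hs : 0 < s) : XiDom s ⊆ Set.Icc 0 (Real.log 2) := by
  unfold XiDom
  rw [if_neg hs.ne']
  split_ifs
  · exact subset_rfl
  · exact Set.Ico_subset_Icc_self

theorem bddAbove_sublevel {s : ℝ} (hs : 0 < s) (t : ℝ) :
    BddAbove {α | α ∈ XiDom s ∧ Xi s α ≤ t} :=
  ⟨Real.log 2, fun _ h => (XiDom_subset_Icc hs h.1).2⟩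

theorem relEntropy_mem_XiDom {s : ℝ} (hs : 0 < s) (τ : ℝ) : relEntropy τ ∈ XiDom s :=
  Ico_subset_XiDom hs ⟨relEntropy_nonneg τ, relEntropy_lt_log_two τ⟩

theorem relEntropy_le_XiInv {s τ : ℝ} (hs : 0 < s) (hτ : 0 ≤ τ) (hτs : τ ≤ s) :
    relEntropy τ ≤ XiInv s (beta s) :=
  le_csSup (bddAbove_sublevel hs _)
    ⟨relEntropy_mem_XiDom hs τ, Xi_relEntropy_le_beta hs hτ hτs⟩

theorem zero_mem_sublevel {s : ℝ} (hs : 0 < s) :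
    (0 : ℝ) ∈ {α | α ∈ XiDom s ∧ Xi s α ≤ beta s} := by
  rw [← relEntropy_zero]
  exact ⟨relEntropy_mem_XiDom hs 0, Xi_relEntropy_le_beta hs le_rfl hs.le⟩

theorem XiInv_nonneg {s : ℝ} (hs : 0 < s) : 0 ≤ XiInv s (beta s) :=
  le_csSup (bddAbove_sublevel hs _) (zero_mem_sublevel hs)

theorem XiInv_le_log_two {s : ℝ} (hs : 0 < s) : XiInv s (beta s) ≤ Real.log 2 :=
  csSup_le ⟨0, zero_mem_sublevel hs⟩ fun _ h => (XiDom_subset_Icc hs h.1).2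

/-- Near `s = 0` the inverse of `Ξ_s` at `β(s)` is quadratically small. -/
theorem XiInv_le_sq {s : ℝ} (hs : 0 < s) (hs2 : s ≤ 1 / 2) :
    XiInv s (beta s) ≤ 16 * s ^ 2 := by
  have hs1 : s ≠ 1 := by linarith
  refine csSup_le ⟨0, zero_mem_sublevel hs⟩ ?_
  rintro α ⟨hα, hle⟩
  rw [XiDom, if_neg hs.ne', if_neg (by linarith)] at hα
  obtain ⟨τ, hτ, rfl⟩ := exists_relEntropy_eq hα.1 hα.2
  rw [Xi_relEntropy hs hs1 hτ, beta, if_neg hs1] at hle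
  have hmul := mul_le_mul_of_nonpos_left hle (by linarith : 2 * (s - 1) ≤ 0)
  have hne : s - 1 ≠ 0 := by linarith
  rw [mul_div_cancel₀ _ (by simpa using hne), ← mul_assoc, mul_one_div_cancel (by simpa using hne),
    one_mul] at hmul
  have he := Real.exp_pos (s - 1)
  have he1 : 0 ≤ Real.exp 1 - 1 := by linarith [Real.add_one_le_exp 1]
  have hy : minorWeight τ * (1 + Real.exp τ) = 1 := by
    have := one_sub_minorWeight τ; linarith
  -- The right side of `hmul` is `1 + (e-1)(1 - e^{s-1}) ≤ e` after rearranging; the second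
  -- exponential is dropped.
  have hexp : minorWeight τ * Real.exp (τ / s) ≤ Real.exp 1 := by
    have := mul_pos (minorWeight_pos τ) (Real.exp_pos (τ * ((s - 1) / s)))
    nlinarith
  have hexp2 : Real.exp (τ / s) ≤ Real.exp 1 * (1 + Real.exp τ) := by
    have := mul_le_mul_of_nonneg_right hexp (by positivity : 0 ≤ 1 + Real.exp τ)
    calc Real.exp (τ / s) = minorWeight τ * Real.exp (τ / s) * (1 + Real.exp τ) := by
          rw [mul_right_comm, hy, one_mul]
      _ ≤ _ := this
  have h2 : (2 : ℝ) ≤ Real.exp 1 := by linarith [Real.add_one_le_exp 1]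
  have hexp3 : Real.exp (τ / s) ≤ Real.exp (2 + τ) := by
    have e : Real.exp (2 + τ) = Real.exp 1 * (Real.exp 1 * Real.exp τ) := by
      rw [← Real.exp_add, ← Real.exp_add]; ring_nf
    rw [e]
    refine hexp2.trans ?_
    gcongr
    nlinarith [Real.one_le_exp hτ]
  have hlin := Real.exp_le_exp.1 hexp3
  rw [div_le_iff₀ hs] at hlin
  -- `τ ≤ 2s + τs ≤ 2s + τ/2`.
  have : τ ≤ 4 * s := by nlinarith
  calc relEntropy τ ≤ τ ^ 2 := relEntropy_le_sq hτ
    _ ≤ (4 * s) ^ 2 := by gcongr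
    _ = 16 * s ^ 2 := by ring

/-! ### Measurability and integrability of the integrand. -/

theorem measurable_beta : Measurable beta := by
  unfold beta
  refine Measurable.ite (measurableSet_singleton 1) measurable_const ?_
  fun_prop

theorem measurable_Xi (α : ℝ) : Measurable fun s => Xi s α := by
  unfold Xi
  refine Measurable.ite (measurableSet_singleton 0) measurable_const
    (Measurable.ite (measurableSet_singleton 1) measurable_const ?_)
  fun_prop

/-- For `s ≠ 1` the strict superlevel sets of `XiInv` are countable unions over rational `α`. -/
theorem lt_XiInv_iff {s c : ℝ} (hs : 0 < s) (hs1 : s ≠ 1) (hc : 0 ≤ c) :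
    c < XiInv s (beta s) ↔
      ∃ a : ℚ, c < a ∧ (a : ℝ) < Real.log 2 ∧ Xi s a ≤ beta s := by
  constructor
  · intro h
    obtain ⟨α, ⟨hα, hle⟩, hcα⟩ := exists_lt_of_lt_csSup ⟨0, zero_mem_sublevel hs⟩ h
    obtain ⟨a, hca, haα⟩ := exists_rat_btwn hcα
    have hαI := XiDom_subset_Icc hs hα
    have ha2 : (a : ℝ) < Real.log 2 := haα.trans_le hαI.2
    refine ⟨a, hca, ha2, le_trans ?_ hle⟩
    obtain ⟨τ, hτ, hτa⟩ := exists_relEntropy_eq (hc.trans hca.le) ha2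
    rw [← hτa]
    rcases hαI.2.lt_or_eq with h2 | h2
    · obtain ⟨u, hu, hua⟩ := exists_relEntropy_eq hαI.1 h2
      rw [← hua]
      refine Xi_relEntropy_mono hs hs1 hτ ?_
      rw [← relEntropy_strictMonoOn.le_iff_le (Set.mem_Ici.2 hτ) (Set.mem_Ici.2 hu), hτa, hua]
      exact haα.le
    -- The endpoint `α = ln 2` has no finite log-odds. It lies in the domain only for `s > 1`, where
    -- `y = 0` gives the maximum `1 / (2(s-1))`.
    · have h1s : 1 < s := by
        by_contra hn
        rw [XiDom, if_neg hs.ne', if_neg hn, h2] at hα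
        exact lt_irrefl _ hα.2
      have hy : yOf α = 0 := by
        have h0 := hInv_spec (t := 0) le_rfl (Real.log_nonneg one_le_two)
        have hz : (0 : ℝ) ∈ Set.Icc (0 : ℝ) 2⁻¹ := ⟨le_rfl, by norm_num⟩
        rw [yOf, h2, sub_self]
        exact Real.binEntropy_strictMonoOn.injOn h0.1 hz (by rw [h0.2, Real.binEntropy_zero])
      have e1 : 1 / s ≠ 0 := by positivity
      have e2 : (s - 1) / s ≠ 0 := div_ne_zero (by linarith) hs.ne'
      rw [Xi_relEntropy hs hs1 hτ, Xi, if_neg hs.ne', if_neg hs1, hy, Real.zero_rpow e1,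
        Real.zero_rpow e2, zero_mul, zero_mul, sub_zero, sub_zero]
      refine mul_le_mul_of_nonneg_left ?_ (one_div_nonneg.2 (by linarith))
      have := minorWeight_pos τ
      rw [sub_le_self_iff]
      positivity
  · rintro ⟨a, hca, ha2, hle⟩
    exact hca.trans_le (le_csSup (bddAbove_sublevel hs _)
      ⟨Ico_subset_XiDom hs ⟨hc.trans hca.le, ha2⟩, hle⟩)

theorem measurable_indicator_XiInv :
    Measurable ((Set.Ioi 0 \ {1}).indicator fun s => XiInv s (beta s)) := by
  have hS : MeasurableSet (Set.Ioi (0 : ℝ) \ {1}) :=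
    measurableSet_Ioi.diff (measurableSet_singleton 1)
  refine measurable_of_Ioi fun c => ?_
  rcases lt_or_ge c 0 with hc | hc
  · convert! MeasurableSet.univ
    refine Set.eq_univ_of_forall fun s => hc.trans_le ?_
    exact Set.indicator_nonneg (fun s hs => XiInv_nonneg hs.1) s
  · have : (Set.Ioi (0 : ℝ) \ {1}).indicator (fun s => XiInv s (beta s)) ⁻¹' Set.Ioi c =
        (Set.Ioi 0 \ {1}) ∩ ⋃ a : ℚ, {s | c < a ∧ (a : ℝ) < Real.log 2 ∧ Xi s a ≤ beta s} := by
      ext s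
      by_cases hs : s ∈ Set.Ioi (0 : ℝ) \ {1}
      · simp only [Set.mem_preimage, Set.indicator_of_mem hs, Set.mem_Ioi, Set.mem_inter_iff, hs,
          true_and, Set.mem_iUnion, Set.mem_ofPred_eq]
        exact lt_XiInv_iff hs.1 hs.2 hc
      · simp only [Set.mem_preimage, Set.indicator_of_notMem hs, Set.mem_Ioi, Set.mem_inter_iff,
          hs, false_and, iff_false]
        exact not_lt.2 hc
    rw [this]
    refine hS.inter (MeasurableSet.iUnion fun a => ?_)
    refine (MeasurableSet.const _).inter ((MeasurableSet.const _).inter ?_)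
    exact measurableSet_le (measurable_Xi a) measurable_beta

theorem intervalIntegrable_XiInv {p q : ℝ} (hp : 0 ≤ p) (hpq : p ≤ q) :
    IntervalIntegrable (fun s => XiInv s (beta s) / s ^ 2) volume p q := by
  rw [intervalIntegrable_iff_integrableOn_Ioc_of_le hpq]
  have hmeas : AEStronglyMeasurable (fun s => XiInv s (beta s) / s ^ 2)
      (volume.restrict (Set.Ioc p q)) := by
    have hm : Measurable fun s : ℝ =>
        (Set.Ioi (0 : ℝ) \ {1}).indicator (fun s => XiInv s (beta s)) s / s ^ 2 :=
      measurable_indicator_XiInv.div (by fun_prop)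
    refine hm.aestronglyMeasurable.congr ?_
    have h1 : ∀ᵐ s : ℝ ∂volume.restrict (Set.Ioc p q), s ≠ 1 :=
      ae_restrict_of_ae (Measure.ae_ne volume 1)
    filter_upwards [h1, ae_restrict_mem measurableSet_Ioc] with s hs1 hs
    rw [Set.indicator_of_mem]
    exact ⟨hp.trans_lt hs.1, hs1⟩
  refine Integrable.of_bound hmeas 16 ?_
  filter_upwards [ae_restrict_mem measurableSet_Ioc] with s hs
  have hs0 : 0 < s := hp.trans_lt hs.1
  rw [Real.norm_eq_abs, abs_of_nonneg (div_nonneg (XiInv_nonneg hs0) (sq_nonneg s)),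
    div_le_iff₀ (by positivity)]
  rcases le_total s (1 / 2) with h | h
  · exact XiInv_le_sq hs0 h
  · have := XiInv_le_log_two hs0
    have := Real.log_two_lt_d9
    nlinarith

/-! ### Two-point entropy bound and tensorization. -/

/-- The entropy of a two-point function with bounded log-ratio. -/
theorem pair_entropy_le {s u v : ℝ} (hs : 0 < s) (hu : 0 < u) (hv : 0 < v)
    (huv : u ≤ Real.exp s * v) (hvu : v ≤ Real.exp s * u) :
    u * Real.log u + v * Real.log v - (u + v) * Real.log ((u + v) / 2) ≤
      XiInv s (beta s) * (u + v) := by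
  wlog h : u ≤ v generalizing u v
  · have := this hv hu hvu huv (le_of_not_ge h)
    rw [add_comm v u] at this
    linarith
  have hr : 1 ≤ v / u := by rwa [le_div_iff₀ hu, one_mul]
  have hτ : Real.log (v / u) ≤ s := by
    rw [Real.log_le_iff_le_exp (by positivity), div_le_iff₀ hu]
    exact hvu
  have hmain := relEntropy_le_XiInv hs (Real.log_nonneg hr) hτ
  have hy : minorWeight (Real.log (v / u)) = u / (u + v) := by
    rw [minorWeight, Real.exp_log (by positivity)]
    field_simp
  have hy' : 1 - u / (u + v) = v / (u + v) := by field_simp; ring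
  rw [relEntropy, hy, Real.binEntropy, Real.log_inv, Real.log_inv, hy',
    Real.log_div hu.ne' (by positivity), Real.log_div hv.ne' (by positivity)] at hmain
  rw [Real.log_div (by positivity) two_ne_zero]
  have := mul_le_mul_of_nonneg_right hmain (by positivity : 0 ≤ u + v)
  refine le_trans (le_of_eq ?_) this
  field_simp
  ring

theorem sum_cons {n : ℕ} (F : (Fin (n + 1) → Bool) → ℝ) :
    ∑ x, F x = ∑ x : Fin n → Bool, F (Fin.cons true x) +
      ∑ x : Fin n → Bool, F (Fin.cons false x) := by
  rw [← (Fin.consEquiv fun _ => Bool).sum_comp, Fintype.sum_prod_type, Fintype.sum_bool]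
  rfl

theorem flip_cons_succ {n : ℕ} (b : Bool) (x : Fin n → Bool) (i : Fin n) :
    flip (Fin.cons b x : Fin (n + 1) → Bool) i.succ = Fin.cons b (flip x i) := by
  simp [flip, Fin.cons_update]

theorem flip_cons_zero {n : ℕ} (b : Bool) (x : Fin n → Bool) :
    flip (Fin.cons b x : Fin (n + 1) → Bool) 0 = Fin.cons (!b) x := by
  simp [flip]

/-- Tensorization: an entropy bound for pairs with bounded ratio extends to the cube. -/
theorem entropy_le_of_flip_le {c K : ℝ}
    (hpair : ∀ u v : ℝ, 0 < u → 0 < v → u ≤ c * v → v ≤ c * u →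
      u * Real.log u + v * Real.log v - (u + v) * Real.log ((u + v) / 2) ≤ K * (u + v))
    {n : ℕ} (F : (Fin n → Bool) → ℝ) (hF : ∀ x, 0 < F x)
    (hflip : ∀ x i, F (flip x i) ≤ c * F x) :
    ∑ x, F x * Real.log (F x) - (∑ x, F x) * Real.log ((∑ x, F x) / 2 ^ n) ≤
      n * K * ∑ x, F x := by
  induction n with
  | zero => simp
  | succ n ih =>
    have hb : ∀ b : Bool, _ := fun b => ih (fun x => F (Fin.cons b x)) (fun x => hF _)
      (fun x i => by rw [← flip_cons_succ]; exact hflip _ _)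
    have ht := hb true
    have hf := hb false
    rw [sum_cons, sum_cons]
    have htpos : 0 < ∑ x : Fin n → Bool, F (Fin.cons true x) :=
      Finset.sum_pos (fun x _ => hF _) Finset.univ_nonempty
    have hfpos : 0 < ∑ x : Fin n → Bool, F (Fin.cons false x) :=
      Finset.sum_pos (fun x _ => hF _) Finset.univ_nonempty
    -- Summing the pointwise ratio bound over the remaining coordinates lets `hpair` apply to the
    -- masses of the two half-cubes.
    have hcross : ∀ b : Bool, ∑ x : Fin n → Bool, F (Fin.cons b x) ≤
        c * ∑ x : Fin n → Bool, F (Fin.cons (!b) x) := by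
      intro b
      rw [Finset.mul_sum]
      refine Finset.sum_le_sum fun x _ => ?_
      have := hflip (Fin.cons (!b) x) 0
      rwa [flip_cons_zero, Bool.not_not] at this
    have hp := hpair _ _ htpos hfpos (hcross true) (hcross false)
    set A := ∑ x : Fin n → Bool, F (Fin.cons true x)
    set B := ∑ x : Fin n → Bool, F (Fin.cons false x)
    have hpow : (2 : ℝ) ^ n ≠ 0 := by positivity
    rw [Real.log_div htpos.ne' hpow] at ht
    rw [Real.log_div hfpos.ne' hpow] at hf
    rw [Real.log_div (by positivity) two_ne_zero] at hp
    rw [pow_succ, Real.log_div (by positivity) (by positivity),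
      Real.log_mul hpow two_ne_zero]
    push_cast
    linarith

/-! ### Log-moments, norms and their derivatives. -/

instance isProbabilityMeasure_unif (n : ℕ) : IsProbabilityMeasure (unif n) := by
  unfold unif; infer_instance

theorem integral_unif {n : ℕ} (f : (Fin n → Bool) → ℝ) :
    ∫ x, f x ∂(unif n) = (∑ x, f x) / 2 ^ n := by
  have h : ∀ x : Fin n → Bool, (unif n).real {x} = 1 / 2 ^ n := by
    intro x
    rw [unif, Measure.real, uniformOn_univ, Measure.count_singleton]
    simp
  rw [integral_fintype Integrable.of_finite]
  simp only [h, smul_eq_mul, ← Finset.mul_sum]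
  ring

/-- The log-moment-generating function of `g` under the uniform law. -/
noncomputable def logMoment {n : ℕ} (g : (Fin n → Bool) → ℝ) (s : ℝ) : ℝ :=
  Real.log ((∑ x, Real.exp (s * g x)) / 2 ^ n)

theorem sum_exp_pos {n : ℕ} (g : (Fin n → Bool) → ℝ) (s : ℝ) : 0 < ∑ x, Real.exp (s * g x) :=
  Finset.sum_pos (fun _ _ => Real.exp_pos _) Finset.univ_nonempty

theorem logMoment_zero {n : ℕ} (g : (Fin n → Bool) → ℝ) : logMoment g 0 = 0 := by
  simp [logMoment]

theorem hasDerivAt_logMoment {n : ℕ} (g : (Fin n → Bool) → ℝ) (s : ℝ) :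
    HasDerivAt (logMoment g)
      ((∑ x, Real.exp (s * g x) * g x) / ∑ x, Real.exp (s * g x)) s := by
  have h1 : HasDerivAt (fun s => ∑ x, Real.exp (s * g x))
      (∑ x, Real.exp (s * g x) * g x) s := by
    refine HasDerivAt.fun_sum fun x _ => ?_
    simpa using ((hasDerivAt_id s).mul_const (g x)).exp
  have hS := sum_exp_pos g s
  have h2 := (h1.div_const ((2 : ℝ) ^ n)).log (by positivity)
  convert! h2 using 1
  field_simp

theorem log_pNorm_zero {n : ℕ} (g : (Fin n → Bool) → ℝ) :
    Real.log (pNorm 0 fun x => Real.exp (g x)) = (∑ x, g x) / 2 ^ n := by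
  rw [pNorm, if_pos rfl, Real.log_exp]
  simp only [Real.log_exp]
  exact integral_unif g

theorem log_pNorm {n : ℕ} (g : (Fin n → Bool) → ℝ) {s : ℝ} (hs : s ≠ 0) :
    Real.log (pNorm s fun x => Real.exp (g x)) = logMoment g s / s := by
  have hS := sum_exp_pos g s
  have e : ∀ x, Real.exp (g x) ^ s = Real.exp (s * g x) := fun x => by
    rw [← Real.exp_mul, mul_comm]
  rw [pNorm, if_neg hs, integral_unif]
  simp only [e]
  rw [Real.log_rpow (by positivity), logMoment]
  ring

/-- At `s = 0` the quotient `logMoment g s / s` is a slope, whose limit is the mean of `g`. This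
makes `p = 0` admissible. -/
theorem continuous_log_pNorm {n : ℕ} (g : (Fin n → Bool) → ℝ) :
    Continuous fun s => Real.log (pNorm s fun x => Real.exp (g x)) := by
  refine continuous_iff_continuousAt.2 fun s => ?_
  by_cases hs : s = 0
  · subst hs
    rw [continuousAt_iff_punctured_nhds, log_pNorm_zero]
    have h := (hasDerivAt_logMoment g 0).tendsto_slope
    have e : (∑ x, Real.exp (0 * g x) * g x) / ∑ x, Real.exp (0 * g x) = (∑ x, g x) / 2 ^ n := by
      simp
    rw [e] at h
    refine h.congr' ?_
    filter_upwards [self_mem_nhdsWithin] with s hs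
    rw [log_pNorm g hs, slope_def_field, logMoment_zero, sub_zero, sub_zero]
  · have h : ContinuousAt (fun s => logMoment g s / s) s :=
      (hasDerivAt_logMoment g s).continuousAt.div continuousAt_id hs
    refine h.congr ?_
    filter_upwards [isOpen_ne.mem_nhds hs] with t ht
    rw [log_pNorm g ht]

theorem hasDerivAt_log_pNorm {n : ℕ} (g : (Fin n → Bool) → ℝ) {s : ℝ} (hs : s ≠ 0) :
    HasDerivAt (fun s => Real.log (pNorm s fun x => Real.exp (g x)))
      (((∑ x, Real.exp (s * g x) * g x) / (∑ x, Real.exp (s * g x)) * s - logMoment g s) / s ^ 2)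
      s := by
  have h := (hasDerivAt_logMoment g s).div (hasDerivAt_id s) hs
  simp only [id, mul_one] at h
  refine h.congr_of_eventuallyEq ?_
  filter_upwards [isOpen_ne.mem_nhds hs] with t ht
  rw [log_pNorm g ht]
  rfl

/-! ### Herbst's argument and the tail bound. -/

/-- The relative entropy of the law tilted by `e^{s g}` is at most `n Ξ_s⁻¹(β(s))`. -/
theorem tilted_entropy_le {n : ℕ} (g : (Fin n → Bool) → ℝ)
    (hg : ∀ (i : Fin n) (x : Fin n → Bool), |grad g i x| ≤ 1) {s : ℝ} (hs : 0 < s) :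
    (∑ x, Real.exp (s * g x) * g x) / (∑ x, Real.exp (s * g x)) * s - logMoment g s ≤
      n * XiInv s (beta s) := by
  have h := entropy_le_of_flip_le (c := Real.exp s) (K := XiInv s (beta s))
    (fun u v hu hv huv hvu => pair_entropy_le hs hu hv huv hvu)
    (fun x => Real.exp (s * g x)) (fun x => Real.exp_pos _) (fun x i => by
      rw [← Real.exp_add, Real.exp_le_exp]
      have := (abs_le.1 (hg i x)).2
      rw [grad] at this
      nlinarith)
  have hS := sum_exp_pos g s
  have e : ∑ x, Real.exp (s * g x) * Real.log (Real.exp (s * g x)) =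
      (∑ x, Real.exp (s * g x) * g x) * s := by
    rw [Finset.sum_mul]
    refine Finset.sum_congr rfl fun x _ => ?_
    rw [Real.log_exp]; ring
  rw [e] at h
  rw [logMoment, div_mul_eq_mul_div, sub_le_iff_le_add, div_le_iff₀ hS]
  linarith

/-- Growth of `q ↦ ln ‖e^g‖_q` for `g` with discrete derivatives bounded by one. -/
theorem log_pNorm_sub_le {n : ℕ} (g : (Fin n → Bool) → ℝ)
    (hg : ∀ (i : Fin n) (x : Fin n → Bool), |grad g i x| ≤ 1) {p q : ℝ} (hp : 0 ≤ p)
    (hpq : p ≤ q) :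
    Real.log (pNorm q fun x => Real.exp (g x)) - Real.log (pNorm p fun x => Real.exp (g x)) ≤
      n * ∫ s in p..q, XiInv s (beta s) / s ^ 2 := by
  rw [← intervalIntegral.integral_const_mul]
  -- Derivatives are needed only in the open interval, which avoids `s = 0`; continuity covers the
  -- endpoints.
  refine intervalIntegral.sub_le_integral_of_hasDeriv_right_of_le hpq
    (continuous_log_pNorm g).continuousOn
    (fun s hs => (hasDerivAt_log_pNorm g (hp.trans_lt hs.1).ne').hasDerivWithinAt) ?_ ?_
  · rw [integrableOn_Icc_iff_integrableOn_Ioc,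
      ← intervalIntegrable_iff_integrableOn_Ioc_of_le hpq]
    exact (intervalIntegrable_XiInv hp hpq).const_mul _
  · intro s hs
    rw [← mul_div_assoc]
    gcongr
    exact tilted_entropy_le g hg (hp.trans_lt hs.1)

theorem unif_tail_le {n : ℕ} (g : (Fin n → Bool) → ℝ)
    (hg : ∀ (i : Fin n) (x : Fin n → Bool), |grad g i x| ≤ 1) {p q : ℝ} (hp : 0 ≤ p)
    (hpq : p ≤ q) (r : ℝ) :
    (unif n).real {x | r ≤ g x - Real.log (pNorm p fun x => Real.exp (g x))} ≤
      Real.exp (n * q * (∫ s in p..q, XiInv s (beta s) / s ^ 2) - r * q) := by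
  set c := Real.log (pNorm p fun x => Real.exp (g x)) with hc
  have hq : 0 ≤ q := hp.trans hpq
  have hset : {x | r ≤ g x - c} = {x | r + c ≤ g x} := by
    ext x; simp only [Set.mem_ofPred_eq, le_sub_iff_add_le]
  have hmgf : mgf g (unif n) q = Real.exp (logMoment g q) := by
    have hS := sum_exp_pos g q
    rw [mgf, integral_unif, logMoment, Real.exp_log (by positivity)]
  have hmom : logMoment g q = q * Real.log (pNorm q fun x => Real.exp (g x)) := by
    rcases hq.eq_or_lt with h | h
    · rw [← h, logMoment_zero, zero_mul]
    · rw [log_pNorm g h.ne', mul_div_cancel₀ _ h.ne']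
  have hgrow := mul_le_mul_of_nonneg_left (log_pNorm_sub_le g hg hp hpq) hq
  rw [hset]
  refine (measure_ge_le_exp_mul_mgf (X := g) (r + c) hq Integrable.of_finite).trans ?_
  rw [hmgf, ← Real.exp_add, Real.exp_le_exp, hmom]
  rw [← hc] at hgrow
  linarith

end Hypercube

theorem corollary2 {n : ℕ} {Ω : Type*} [MeasurableSpace Ω] (P : Measure Ω) [IsProbabilityMeasure P]
    (X : Ω → Fin n → Bool) (hX : HasLaw X (Hypercube.unif n) P)
    (g : (Fin n → Bool) → ℝ) (hg : ∀ (i : Fin n) (x : Fin n → Bool), |Hypercube.grad g i x| ≤ 1)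
    (p : ℝ) (hp : p ∈ Set.Icc (0 : ℝ) 2) :
    IntervalIntegrable (fun s => Hypercube.XiInv s (Hypercube.beta s) / s ^ 2) volume p 2 ∧
    ∀ r : ℝ,
      P.real {ω | r ≤ g (X ω) - Real.log (Hypercube.pNorm p (fun x => Real.exp (g x)))} ≤
        Real.exp (⨅ q : Set.Icc p 2,
          ((n : ℝ) * (q : ℝ) *
              (∫ s in p..(q : ℝ), Hypercube.XiInv s (Hypercube.beta s) / s ^ 2)
            - r * (q : ℝ))) := by
  refine ⟨Hypercube.intervalIntegrable_XiInv hp.1 hp.2, fun r => ?_⟩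
  have : Nonempty (Set.Icc p 2) := ⟨⟨p, le_rfl, hp.2⟩⟩
  rw [Measure.real, hX.measure_eq
    (p := fun x => r ≤ g x - Real.log (Hypercube.pNorm p (fun x => Real.exp (g x))))
    (Set.toFinite _).measurableSet, ← Measure.real]
  have htail := fun q : Set.Icc p 2 => Hypercube.unif_tail_le g hg hp.1 q.2.1 r
  -- Taking logarithms turns the claim into one bound for each `q`; this requires positive
  -- probability.
  rcases (measureReal_nonneg (μ := Hypercube.unif n) (s :=
    {x | r ≤ g x - Real.log (Hypercube.pNorm p (fun x => Real.exp (g x)))})).eq_or_lt with h | h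
  · rw [← h]
    exact (Real.exp_pos _).le
  · rw [← Real.log_le_iff_le_exp h]
    exact le_ciInf fun q => (Real.log_le_iff_le_exp h).2 (htail q)
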